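/- Fix two strongly inaccessible cardinals $\kappa_0<\kappa_1$. Small means of size $<\kappa_0$, moderately small means of size $<\kappa_1$; $Cat$ is the $1$-category of small categories, and for moderately small categories $X,Y$ let $[X,Y]$ denote the set of isomorphism classes of functors $X\to Y$ (the morphisms $X\to Y$ of the homotopy category of categories). For a functor $x:U\to Cat$ with $U$ moderately small, let $\llbracket x\rrbracket$ be the oplax colimit (Grothendieck construction) of $x$: its objects are pairs $(u,i)$ with $u\in U$, $i\in x(u)$, and a morphism $(u,i)\to(v,j)$ is a pair $(\alpha:u\to v,\ \beta:x(\alpha)(i)\to j)$. For $f:\llbracket x\rrbracket\to Cat$ let $\sum_x f:U\to Cat$ be the functor sending $u$ to the oplax colimit of $f(u,-):x(u)\to Cat$, and let $f^\flat:\llbracket f\rrbracket\to\llbracket \sum_x f\rrbracket$ be the functor $((u,i),j)\mapsto(u,(i,j))$. A right $Cat$-module is a category $M$ together with a function $\sum_x:[\llbracket x\rrbracket,M]\to[U,M]$ for every such $x$, such that 1. for every functor $h:U\to V$, every $y:V\to Cat$ and every isomorphism $x\cong y\circ h$, with induced functor $\tilde h:\llbracket x\rrbracket\to\llbracket y\rrbracket$,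 one has $\sum_x(g\circ\tilde h)=(\sum_y g)\circ h$ for all $g\in[\llbracket y\rrbracket,M]$; 2. $\sum_{\mathrm{const}_1}(g\circ p)=g$ for $g\in[U,M]$, where $\mathrm{const}_1:U\to Cat$ is constant at the terminal category and $p:\llbracket \mathrm{const}_1\rrbracket\to U$ is the projection; 3. $\sum_{\sum_x f}g=\sum_x\sum_f(g\circ f^\flat)$ for $f:\llbracket x\rrbracket\to Cat$ and $g\in[\llbracket\sum_x f\rrbracket,M]$. A morphism $\varphi\in[M,N]$ between right $Cat$-modules is $Cat$-linear if $\varphi\circ\sum_x f=\sum_x(\varphi\circ f)$ for every moderately small $U$, every $x:U\to Cat$ and every $f\in[\llbracket x\rrbracket,M]$. Every category $M$ with all small colimits is a right $Cat$-module, where for $f:\llbracket x\rrbracket\to M$ the sum $\sum_x f$ is the class of the functor $u\mapsto\operatorname{colim}_{i\in x(u)}f(u,i)$ with the canonical maps between these colimits. **Theorem.** Let $C$, $D$ be categories with all small colimits, regarded as right $Cat$-modules with colimits as dependent sums. Then a functor $F:C\to D$ is (more precisely, its isomorphism class is) a $Cat$-linear map if and only if $F$ preserves small colimits, i.e. sends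 small colimit cocones to small colimit cocones. -/

import Mathlib

open CategoryTheory CategoryTheory.Limits

universe w u u₁ v₁ u₂ v₂ u₃ v₃ u₄ v₄

set_option linter.checkUnivs false

noncomputable section

/-- Morphisms of the homotopy category of categories: isomorphism classes of functors. -/
def HoFunctor (C : Type u₁) [Category.{v₁} C] (D : Type u₂) [Category.{v₂} D] : Type _ :=
  Quotient (isIsomorphicSetoid (C ⥤ D))

namespace HoFunctor

variable {C : Type u₁} [Category.{v₁} C] {D : Type u₂} [Category.{v₂} D]
  {E : Type u₃} [Category.{v₃} E] {E' : Type u₄} [Category.{v₄} E']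

/-- The class of a functor. -/
def mk (F : C ⥤ D) : HoFunctor C D := Quotient.mk (isIsomorphicSetoid (C ⥤ D)) F

theorem mk_eq_mk_iff {F G : C ⥤ D} : mk F = mk G ↔ Nonempty (F ≅ G) :=
  Quotient.eq (r := isIsomorphicSetoid (C ⥤ D))

theorem ind {P : HoFunctor C D → Prop} (h : ∀ F : C ⥤ D, P (mk F)) (φ : HoFunctor C D) : P φ :=
  Quotient.ind h φ

/-- Composition (in diagrammatic order) of isomorphism classes of functors. -/
def comp (φ : HoFunctor C D) (ψ : HoFunctor D E) : HoFunctor C E :=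
  Quotient.map₂ (sa := isIsomorphicSetoid (C ⥤ D)) (sb := isIsomorphicSetoid (D ⥤ E))
    (sc := isIsomorphicSetoid (C ⥤ E)) (fun F G => F ⋙ G)
    (fun _ _ ⟨a⟩ _ _ ⟨b⟩ => ⟨Functor.isoWhiskerRight a _ ≪≫ Functor.isoWhiskerLeft _ b⟩) φ ψ

@[simp]
theorem mk_comp_mk (F : C ⥤ D) (G : D ⥤ E) : (mk F).comp (mk G) = mk (F ⋙ G) := rfl

theorem id_comp (φ : HoFunctor C D) : (mk (𝟭 C)).comp φ = φ := by
  induction φ using ind with | _ F => rfl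

theorem comp_id (φ : HoFunctor C D) : φ.comp (mk (𝟭 D)) = φ := by
  induction φ using ind with | _ F => rfl

theorem comp_assoc (φ : HoFunctor C D) (ψ : HoFunctor D E) (χ : HoFunctor E E') :
    (φ.comp ψ).comp χ = φ.comp (ψ.comp χ) := by
  induction φ using ind with | _ F =>
  induction ψ using ind with | _ G =>
  induction χ using ind with | _ H => rfl

end HoFunctor

namespace CatAdder

section Sums

variable {U : Type u₁} [Category.{v₁} U]

theorem hom_hext {x : U ⥤ Cat.{w, w}} {X Y : Grothendieck x} {k l : X ⟶ Y}
    (hb : k.base = l.base) (hf : k.fiber ≍ l.fiber) : k = l := by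
  obtain ⟨kb, kf⟩ := k
  obtain ⟨lb, lf⟩ := l
  dsimp only at hb
  subst hb
  dsimp only at hf
  rw [eq_of_heq hf]

theorem comp_eqToHom_mk {x : U ⥤ Cat.{w, w}} {X : Grothendieck x} {c : U} {j j' : x.obj c}
    (m : X ⟶ ⟨c, j⟩) (h : j = j') :
    m ≫ eqToHom (congrArg (Grothendieck.mk c) h) = ⟨m.base, m.fiber ≫ eqToHom h⟩ := by
  subst h
  refine (Category.comp_id m).trans (hom_hext rfl ?_)
  exact heq_of_eq (Category.comp_id m.fiber).symm

theorem hom_heq {x : U ⥤ Cat.{w, w}} {X X' Y : Grothendieck x} (hX : X = X') {k : X ⟶ Y}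
    {l : X' ⟶ Y} (hb : k.base ≍ l.base) (hf : k.fiber ≍ l.fiber) : k ≍ l := by
  subst hX
  exact heq_of_eq (hom_hext (eq_of_heq hb) hf)

theorem eqToHom_toNatTrans_app {A B : Cat.{w, w}} {F G : A ⟶ B} (h : F = G) (a : A)
    (h' : F.toFunctor.obj a = G.toFunctor.obj a) :
    (eqToHom h).toNatTrans.app a = eqToHom h' := by
  subst h
  rfl

theorem map_comp_heq {A B C : Type w} [Category.{w} A] [Category.{w} B] [Category.{w} C]
    (H : A ⥤ B) (G : B ⥤ C) (K : A ⥤ C) (hK : K = H ⋙ G) {a₀ a a' : A} (h₀ : a₀ = a)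
    (c : a ⟶ a') {b : B} (s : b ⟶ H.obj a₀) (h₁ : b = H.obj a₀)
    (hs : s = eqToHom h₁) {d : C} (h₂ : d = G.obj b)
    (h₃ : G.obj (H.obj a') = K.obj a') {z : C} (c' : K.obj a' ⟶ z) :
    eqToHom h₂ ≫ G.map (s ≫ H.map (eqToHom h₀ ≫ c)) ≫ eqToHom h₃ ≫ c' ≍
      K.map c ≫ c' := by
  subst hK h₀ h₁ h₂ hs
  simp

theorem id_heq {A B : Type w} [Category.{w} A] [Category.{w} B] (q : A ⥤ B) (a : A) {b b' : B}
    (e : b = q.obj a) (h : q.obj a = b') :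
    𝟙 b' ≍ (eqToHom e ≫ q.map (𝟙 a) ≫ 𝟙 (q.obj a)) ≫ eqToHom h := by
  subst e h
  simp

theorem fiber_heq {A B : Type w} [Category.{w} A] [Category.{w} B] (q : A ⥤ B) (a : A) {b b' z : B}
    (e : b = q.obj a) (h : q.obj a = b') (k : b' ⟶ z) :
    eqToHom e ≫ q.map (𝟙 a) ≫ eqToHom h ≫ k ≍ k := by
  subst e h
  simp

/-- The functor between the oplax colimits of `f(a, -)` and `f(b, -)` that is induced by a functor
`g` between the index categories and a transformation `τ`; on objects it is
`(i, j) ↦ (g i, f(τ i) j)`. -/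
def oplaxMap (x : U ⥤ Cat.{w, w}) (f : Grothendieck x ⥤ Cat.{w, w}) {a b : U}
    (g : x.obj a ⥤ x.obj b) (τ : Grothendieck.ι x a ⟶ g ⋙ Grothendieck.ι x b) :
    Grothendieck (Grothendieck.ι x a ⋙ f) ⥤ Grothendieck (Grothendieck.ι x b ⋙ f) :=
  Grothendieck.map (G := g ⋙ Grothendieck.ι x b ⋙ f) (Functor.whiskerRight τ f) ⋙
    Grothendieck.pre (Grothendieck.ι x b ⋙ f) g

theorem oplaxMap_id (x : U ⥤ Cat.{w, w}) (f : Grothendieck x ⥤ Cat.{w, w}) {a : U}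
    (g : x.obj a ⥤ x.obj a) (hg : g = 𝟭 _)
    (τ : Grothendieck.ι x a ⟶ g ⋙ Grothendieck.ι x a)
    (hτ : τ = eqToHom (by rw [hg]; rfl)) :
    oplaxMap x f g τ = 𝟭 _ := by
  subst hg
  subst hτ
  have : Functor.whiskerRight (𝟙 (Grothendieck.ι x a)) f = 𝟙 (Grothendieck.ι x a ⋙ f) := by
    ext; simp
  exact (congrArg Grothendieck.map this).trans Grothendieck.map_id_eq

theorem oplaxMap_comp (x : U ⥤ Cat.{w, w}) (f : Grothendieck x ⥤ Cat.{w, w}) {a b c : U}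
    (g : x.obj a ⥤ x.obj b) (h : x.obj b ⥤ x.obj c) (k : x.obj a ⥤ x.obj c) (hk : k = g ⋙ h)
    (τ : Grothendieck.ι x a ⟶ g ⋙ Grothendieck.ι x b)
    (σ : Grothendieck.ι x b ⟶ h ⋙ Grothendieck.ι x c)
    (ρ : Grothendieck.ι x a ⟶ k ⋙ Grothendieck.ι x c)
    (hρ : ρ = τ ≫ Functor.whiskerLeft g σ ≫ eqToHom (by rw [hk]; rfl)) :
    oplaxMap x f k ρ = oplaxMap x f g τ ⋙ oplaxMap x f h σ := by
  subst hk
  subst hρ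
  have e : Functor.whiskerRight (τ ≫ Functor.whiskerLeft g σ ≫ 𝟙 (g ⋙ h ⋙ Grothendieck.ι x c)) f =
      Functor.whiskerRight τ f ≫ Functor.whiskerLeft g (Functor.whiskerRight σ f) := by
    ext; simp
  refine (congrArg (fun t => Grothendieck.map
    (G := (g ⋙ h) ⋙ Grothendieck.ι x c ⋙ f) t ⋙
      Grothendieck.pre (Grothendieck.ι x c ⋙ f) (g ⋙ h)) e).trans ?_
  exact congrArg (fun t => t ⋙ Grothendieck.pre (Grothendieck.ι x c ⋙ f) (g ⋙ h))
    (Grothendieck.map_comp_eq _ _)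

theorem ιNatTrans_id (x : U ⥤ Cat.{w, w}) (a : U) :
    Grothendieck.ιNatTrans (F := x) (𝟙 a) = eqToHom (by rw [x.map_id]; rfl) := by
  ext i
  rw [eqToHom_app, Grothendieck.eqToHom_eq]
  rfl

theorem ιNatTrans_comp (x : U ⥤ Cat.{w, w}) {a b c : U} (p : a ⟶ b) (q : b ⟶ c) :
    Grothendieck.ιNatTrans (F := x) (p ≫ q) = Grothendieck.ιNatTrans p ≫
      Functor.whiskerLeft (x.map p).toFunctor (Grothendieck.ιNatTrans q) ≫
        eqToHom (by rw [x.map_comp]; rfl) := by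
  ext i
  have h : (x.map q).toFunctor.obj ((x.map p).toFunctor.obj i) =
      (x.map (p ≫ q)).toFunctor.obj i := by rw [x.map_comp]; rfl
  rw [NatTrans.comp_app, NatTrans.comp_app, eqToHom_app, ← Category.assoc]
  refine Eq.trans ?_ (comp_eqToHom_mk (((Grothendieck.ιNatTrans p).app i ≫
    (Grothendieck.ιNatTrans q).app ((x.map p).toFunctor.obj i) :)) h).symm
  refine hom_hext rfl ?_
  exact id_heq (x.map q).toFunctor _ _ h

/-- The sum of a family `f : ⟦x⟧ ⥤ Cat` of small categories: at `u` it is the oplax colimit of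
`f(u, -)` over `x(u)`. -/
def oplaxSum (x : U ⥤ Cat.{w, w}) (f : Grothendieck x ⥤ Cat.{w, w}) : U ⥤ Cat.{w, w} where
  obj u := Cat.of (Grothendieck (Grothendieck.ι x u ⋙ f))
  map p := (oplaxMap x f (x.map p).toFunctor (Grothendieck.ιNatTrans p)).toCatHom
  map_id u := congrArg Functor.toCatHom
    (oplaxMap_id x f _ (congrArg Cat.Hom.toFunctor (x.map_id u)) _ (ιNatTrans_id x u))
  map_comp p q := congrArg Functor.toCatHom
    (oplaxMap_comp x f _ _ _ (congrArg Cat.Hom.toFunctor (x.map_comp p q)) _ _ _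
      (ιNatTrans_comp x p q))

theorem ιNatTrans_app_comp_ι_map (x : U ⥤ Cat.{w, w}) {X Y : Grothendieck x} (k : X ⟶ Y) :
    (Grothendieck.ιNatTrans (F := x) k.base).app X.fiber ≫
      (Grothendieck.ι x Y.base).map k.fiber = k := by
  refine hom_hext (Category.comp_id _) ?_
  exact fiber_heq (x.map (𝟙 Y.base)).toFunctor _ _ _ k.fiber

theorem map_toFunctor_obj_of_hom {x : U ⥤ Cat.{w, w}} (f : Grothendieck x ⥤ Cat.{w, w})
    {X Y : Grothendieck x} (k : X ⟶ Y) (j : f.obj X) :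
    (f.map k).toFunctor.obj j =
      (f.map ((Grothendieck.ι x Y.base).map k.fiber)).toFunctor.obj
        ((f.map ((Grothendieck.ιNatTrans (F := x) k.base).app X.fiber)).toFunctor.obj j) := by
  conv_lhs => rw [← ιNatTrans_app_comp_ι_map x k]
  exact congrArg (fun t : f.obj X ⟶ f.obj Y => t.toFunctor.obj j) (f.map_comp _ _)

/-- The flattening map `((u, i), j) ↦ (u, (i, j))`. -/
def flat (x : U ⥤ Cat.{w, w}) (f : Grothendieck x ⥤ Cat.{w, w}) :
    Grothendieck f ⥤ Grothendieck (oplaxSum x f) where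
  obj X := ⟨X.base.base, ⟨X.base.fiber, X.fiber⟩⟩
  map {X Y} k := ⟨k.base.base, ⟨k.base.fiber,
    eqToHom (map_toFunctor_obj_of_hom f k.base X.fiber).symm ≫ k.fiber⟩⟩
  map_id X := by
    refine hom_hext rfl ?_
    have h : ((oplaxSum x f).map (𝟙 X.base.base)).toFunctor.obj ⟨X.base.fiber, X.fiber⟩ =
        ⟨X.base.fiber, X.fiber⟩ := by
      rw [(oplaxSum x f).map_id]; rfl
    refine HEq.trans ?_ (heq_of_eq (Grothendieck.eqToHom_eq h).symm)
    refine heq_of_eq (hom_hext rfl ?_)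
    have h' : (f.map (𝟙 X.base)).toFunctor.obj X.fiber = X.fiber := by
      rw [f.map_id]; rfl
    exact heq_of_eq (eqToHom_trans (map_toFunctor_obj_of_hom f (𝟙 X.base) X.fiber).symm h')
  map_comp {X Y Z} k l := by
    refine hom_hext rfl ?_
    refine HEq.trans ?_ (eqToHom_comp_heq _ _).symm
    refine hom_heq (congrArg (fun t : (oplaxSum x f).obj _ ⟶ (oplaxSum x f).obj _ =>
      t.toFunctor.obj _) ((oplaxSum x f).map_comp k.base.base l.base.base)) ?_ ?_
    · exact eqToHom_comp_heq _ _
    · refine (eqToHom_comp_heq _ _).trans ((eqToHom_comp_heq _ _).trans ?_)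
      let F₁ := (f.map ((Grothendieck.ιNatTrans (F := x) l.base.base).app Y.base.fiber)).toFunctor
      let F₂ := (f.map ((Grothendieck.ι x Z.base.base).map l.base.fiber)).toFunctor
      have hF : (f.map l.base).toFunctor = F₁ ⋙ F₂ := by
        conv_lhs => rw [← ιNatTrans_app_comp_ι_map x l.base]
        exact congrArg (fun t : f.obj Y.base ⟶ f.obj Z.base => t.toFunctor) (f.map_comp _ _)
      refine (map_comp_heq F₁ F₂ (f.map l.base).toFunctor hF
        (map_toFunctor_obj_of_hom f k.base X.fiber).symm k.fiber _ ?_ ?_ ?_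
        (congrArg (fun t : _ ⥤ _ => t.obj Y.fiber) hF).symm l.fiber).symm
      · exact congrArg (fun t : _ ⟶ f.obj ((Grothendieck.ι x Z.base.base).obj
          ((x.map l.base.base).toFunctor.obj Y.base.fiber)) => t.toFunctor.obj
            ((f.map ((Grothendieck.ιNatTrans (F := x) k.base.base).app X.base.fiber)).toFunctor.obj
              X.fiber))
          ((Functor.whiskerRight (Grothendieck.ιNatTrans (F := x) l.base.base) f).naturality
            k.base.fiber).symm
      · exact eqToHom_toNatTrans_app _ _ _

instance flat_essSurj (x : U ⥤ Cat.{w, w}) (f : Grothendieck x ⥤ Cat.{w, w}) :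
    (flat x f).EssSurj where
  mem_essImage Y := ⟨⟨⟨Y.base, Y.fiber.base⟩, Y.fiber.fiber⟩, ⟨Iso.refl _⟩⟩

instance flat_full (x : U ⥤ Cat.{w, w}) (f : Grothendieck x ⥤ Cat.{w, w}) :
    (flat x f).Full where
  map_surjective {X Y} k := by
    let b : X.base ⟶ Y.base := ⟨k.base, k.fiber.base⟩
    refine ⟨⟨b, eqToHom (map_toFunctor_obj_of_hom f b X.fiber) ≫ k.fiber.fiber⟩, ?_⟩
    refine hom_hext rfl (heq_of_eq (hom_hext rfl ?_))
    exact (eqToHom_comp_heq _ _).trans (eqToHom_comp_heq _ _)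

instance flat_faithful (x : U ⥤ Cat.{w, w}) (f : Grothendieck x ⥤ Cat.{w, w}) :
    (flat x f).Faithful where
  map_injective {X Y} k l h := by
    obtain ⟨⟨a, b⟩, c⟩ := k
    obtain ⟨⟨a', b'⟩, c'⟩ := l
    have h₁ := Grothendieck.Hom.mk.inj h
    obtain ⟨ha, h₂⟩ := h₁
    dsimp only at ha
    subst ha
    obtain ⟨hb, h₃⟩ := Grothendieck.Hom.mk.inj (eq_of_heq h₂)
    dsimp only at hb
    subst hb
    have h₄ : c = c' := eq_of_heq
      ((eqToHom_comp_heq _ _).symm.trans (h₃.trans (eqToHom_comp_heq _ _)))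
    rw [h₄]

instance flat_isEquivalence (x : U ⥤ Cat.{w, w}) (f : Grothendieck x ⥤ Cat.{w, w}) :
    (flat x f).IsEquivalence where

instance map_isEquivalence {x y : U ⥤ Cat.{w, w}} (α : x ≅ y) :
    (Grothendieck.map α.hom).IsEquivalence :=
  (CategoryTheory.Equivalence.mk (Grothendieck.map α.hom) (Grothendieck.map α.inv)
    (eqToIso (by rw [← Grothendieck.map_comp_eq, α.hom_inv_id, Grothendieck.map_id_eq]))
    (eqToIso (by rw [← Grothendieck.map_comp_eq, α.inv_hom_id, Grothendieck.map_id_eq]))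
      ).isEquivalence_functor

/-- The constant family at the terminal category, i.e. at the unit of `Cat`. -/
def constOne (U : Type u₁) [Category.{v₁} U] : U ⥤ Cat.{w, w} :=
  (Functor.const U).obj (Cat.of (Discrete PUnit.{w + 1}))

instance forget_constOne_isEquivalence :
    (Grothendieck.forget (constOne.{w} U)).IsEquivalence where
  faithful := ⟨fun {X Y} k l h => by
    have h₁ : k.base = l.base := h
    obtain ⟨a, b⟩ := k
    obtain ⟨a', b'⟩ := l
    dsimp only at h₁
    subst h₁
    exact hom_hext rfl (heq_of_eq (Subsingleton.elim
      (α := (⟨⟨⟩⟩ : Discrete PUnit.{w + 1}) ⟶ ⟨⟨⟩⟩) b b'))⟩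
  full := ⟨fun {X Y} k => ⟨⟨k, eqToHom (Subsingleton.elim (α := Discrete PUnit) _ _)⟩, rfl⟩⟩
  essSurj := ⟨fun u => ⟨⟨u, ⟨⟨⟩⟩⟩, ⟨Iso.refl _⟩⟩⟩

end Sums

section Lan

variable {U : Type u₁} [Category.{v₁} U] {M : Type u₂} [Category.{v₂} M]
  [HasColimitsOfSize.{w, w} M]

theorem ι_fiberwiseColimit_map (x : U ⥤ Cat.{w, w}) (f : Grothendieck x ⥤ M) {u v : U}
    (p : u ⟶ v) (i : x.obj u) :
    colimit.ι (Grothendieck.ι x u ⋙ f) i ≫ (fiberwiseColimit f).map p =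
      f.map ((Grothendieck.ιNatTrans (F := x) p).app i) ≫
        colimit.ι (Grothendieck.ι x v ⋙ f) ((x.map p).toFunctor.obj i) := by
  simp [fiberwiseColimit]

/-- The cocone under a fibre that is induced by a transformation to a functor on the base. -/
def fiberCocone (x : U ⥤ Cat.{w, w}) (f : Grothendieck x ⥤ M) {K : U ⥤ M}
    (β : f ⟶ Grothendieck.forget x ⋙ K) (u : U) : Cocone (Grothendieck.ι x u ⋙ f) where
  pt := K.obj u
  ι :=
    { app := fun i => β.app ⟨u, i⟩
      naturality := fun i j k => by
        have h : K.map ((Grothendieck.ι x u).map k).base = 𝟙 _ := K.map_id u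
        exact (β.naturality ((Grothendieck.ι x u).map k)).trans
          (congrArg (β.app ⟨u, i⟩ ≫ ·) h) }

/-- The universal property of the fibrewise colimit. -/
def fiberwiseDesc (x : U ⥤ Cat.{w, w}) (f : Grothendieck x ⥤ M) {K : U ⥤ M}
    (β : f ⟶ Grothendieck.forget x ⋙ K) : fiberwiseColimit f ⟶ K where
  app u := colimit.desc (Grothendieck.ι x u ⋙ f) (fiberCocone x f β u)
  naturality u v p := by
    refine colimit.hom_ext fun i => ?_
    have h₁ := ι_fiberwiseColimit_map x f p i =≫
      colimit.desc (Grothendieck.ι x v ⋙ f) (fiberCocone x f β v)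
    refine (Category.assoc _ _ _).symm.trans (h₁.trans ((Category.assoc _ _ _).trans ?_))
    refine (congrArg (f.map ((Grothendieck.ιNatTrans (F := x) p).app i) ≫ ·)
      (colimit.ι_desc (fiberCocone x f β v) _)).trans ?_
    refine (β.naturality ((Grothendieck.ιNatTrans (F := x) p).app i)).trans ?_
    exact (colimit.ι_desc_assoc (fiberCocone x f β u) i (K.map p)).symm

/-- Fibrewise colimits are left Kan extensions along the projection. -/
instance fiberwiseColimit_isLeftKanExtension (x : U ⥤ Cat.{w, w}) (f : Grothendieck x ⥤ M) :
    (fiberwiseColimit f).IsLeftKanExtension (natTransIntoForgetCompFiberwiseColimit f) where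
  nonempty_isUniversal := ⟨IsInitial.ofUniqueHom
    (fun E => StructuredArrow.homMk (fiberwiseDesc x f E.hom) (by
      refine NatTrans.ext (funext fun X => ?_)
      exact colimit.ι_desc (fiberCocone x f E.hom X.base) X.fiber))
    (fun E m => by
      refine StructuredArrow.hom_ext _ _ (NatTrans.ext (funext fun u => ?_))
      refine colimit.hom_ext fun i => ?_
      refine Eq.trans ?_ (colimit.ι_desc (fiberCocone x f E.hom u) i).symm
      exact NatTrans.congr_app (StructuredArrow.w m) (⟨u, i⟩ : Grothendieck x))⟩

theorem isoClass_oplaxSum (x : U ⥤ Cat.{w, w}) (f : Grothendieck x ⥤ Cat.{w, w})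
    (g : Grothendieck (oplaxSum x f) ⥤ M) :
    Nonempty (fiberwiseColimit g ≅ fiberwiseColimit (fiberwiseColimit (flat x f ⋙ g))) := by
  let γ₁ : flat x f ⋙ g ⟶ (flat x f ⋙ Grothendieck.forget (oplaxSum x f)) ⋙
      fiberwiseColimit g :=
    Functor.whiskerLeft (flat x f) (natTransIntoForgetCompFiberwiseColimit g)
  let γ₂ : flat x f ⋙ g ⟶ (flat x f ⋙ Grothendieck.forget (oplaxSum x f)) ⋙
      fiberwiseColimit (fiberwiseColimit (flat x f ⋙ g)) :=
    natTransIntoForgetCompFiberwiseColimit (flat x f ⋙ g) ≫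
      Functor.whiskerLeft (Grothendieck.forget f)
        (natTransIntoForgetCompFiberwiseColimit (fiberwiseColimit (flat x f ⋙ g)))
  have h₁ : (fiberwiseColimit g).IsLeftKanExtension γ₁ :=
    (Functor.isLeftKanExtension_iff_postcompose (α := 𝟙 (flat x f ⋙ g))
      (L := flat x f) (L' := Grothendieck.forget (oplaxSum x f)) _ (Iso.refl _)
      (natTransIntoForgetCompFiberwiseColimit g) γ₁ (by
        ext X; simp [γ₁]; exact Category.comp_id _)).mp inferInstance
  have h₂ : (fiberwiseColimit (fiberwiseColimit (flat x f ⋙ g))).IsLeftKanExtension γ₂ :=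
    (Functor.isLeftKanExtension_iff_postcompose
      (α := natTransIntoForgetCompFiberwiseColimit (flat x f ⋙ g))
      (L := Grothendieck.forget f) (L' := Grothendieck.forget x) _ (Iso.refl _)
      (natTransIntoForgetCompFiberwiseColimit (fiberwiseColimit (flat x f ⋙ g))) γ₂ (by
        ext X; simp [γ₂]; exact congrArg (_ ≫ ·) (Category.comp_id _))).mp inferInstance
  exact ⟨Functor.leftKanExtensionUnique _ γ₁ _ γ₂⟩

theorem isoClass_constOne (f : U ⥤ M) :
    Nonempty (fiberwiseColimit (Grothendieck.forget (constOne.{w} U) ⋙ f) ≅ f) :=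
  ⟨Functor.leftKanExtensionUnique _
    (natTransIntoForgetCompFiberwiseColimit (Grothendieck.forget (constOne.{w} U) ⋙ f)) f
    (𝟙 (Grothendieck.forget (constOne.{w} U) ⋙ f))⟩

theorem isoClass_map {x y : U ⥤ Cat.{w, w}} (α : x ≅ y) (f : Grothendieck y ⥤ M) :
    Nonempty (fiberwiseColimit (Grothendieck.map α.hom ⋙ f) ≅ fiberwiseColimit f) := by
  let γ : Grothendieck.map α.hom ⋙ f ⟶
      (Grothendieck.map α.hom ⋙ Grothendieck.forget y) ⋙ fiberwiseColimit f :=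
    Functor.whiskerLeft (Grothendieck.map α.hom) (natTransIntoForgetCompFiberwiseColimit f)
  have h : (fiberwiseColimit f).IsLeftKanExtension γ :=
    (Functor.isLeftKanExtension_iff_postcompose (α := 𝟙 (Grothendieck.map α.hom ⋙ f))
      (L := Grothendieck.map α.hom) (L' := Grothendieck.forget y) _ (Iso.refl _)
      (natTransIntoForgetCompFiberwiseColimit f) γ (by
        ext X; simp [γ]; exact Category.comp_id _)).mp inferInstance
  let γ₀ : Grothendieck.map α.hom ⋙ f ⟶ (Grothendieck.map α.hom ⋙ Grothendieck.forget y) ⋙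
      fiberwiseColimit (Grothendieck.map α.hom ⋙ f) :=
    natTransIntoForgetCompFiberwiseColimit (Grothendieck.map α.hom ⋙ f)
  have h₀ : (fiberwiseColimit (Grothendieck.map α.hom ⋙ f)).IsLeftKanExtension γ₀ :=
    fiberwiseColimit_isLeftKanExtension x (Grothendieck.map α.hom ⋙ f)
  exact ⟨Functor.leftKanExtensionUnique _ γ₀ _ γ⟩

theorem isoClass_pre {V : Type u₃} [Category.{v₃} V] (h : V ⥤ U) (y : U ⥤ Cat.{w, w})
    (f : Grothendieck y ⥤ M) :
    Nonempty (fiberwiseColimit (Grothendieck.pre y h ⋙ f) ≅ h ⋙ fiberwiseColimit f) := by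
  let β : Grothendieck.pre y h ⋙ f ⟶ Grothendieck.forget (h ⋙ y) ⋙ h ⋙ fiberwiseColimit f :=
    Functor.whiskerLeft (Grothendieck.pre y h) (natTransIntoForgetCompFiberwiseColimit f)
  have : ∀ v, IsIso ((fiberwiseDesc (h ⋙ y) (Grothendieck.pre y h ⋙ f) β).app v) := by
    intro v
    let e : Grothendieck.ι (h ⋙ y) v ⋙ Grothendieck.pre y h ⋙ f ≅
        Grothendieck.ι y (h.obj v) ⋙ f :=
      NatIso.ofComponents (fun _ => Iso.refl _) (fun {i j} k => by
        refine (Category.comp_id _).trans (Eq.trans (congrArg f.map ?_) (Category.id_comp _).symm)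
        exact hom_hext (h.map_id v) ((eqToHom_comp_heq k _).trans (eqToHom_comp_heq k _).symm))
    have : (fiberwiseDesc (h ⋙ y) (Grothendieck.pre y h ⋙ f) β).app v =
        (HasColimit.isoOfNatIso e).hom := by
      refine colimit.hom_ext fun i => ?_
      refine (colimit.ι_desc (fiberCocone (h ⋙ y) (Grothendieck.pre y h ⋙ f) β v) i).trans ?_
      refine Eq.trans ?_ (HasColimit.isoOfNatIso_ι_hom e i).symm
      exact (Category.id_comp _).symm
    rw [this]
    exact Iso.isIso_hom _
  exact ⟨NatIso.ofComponents (fun v => asIso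
    ((fiberwiseDesc (h ⋙ y) (Grothendieck.pre y h ⋙ f) β).app v))
    (fun p => (fiberwiseDesc (h ⋙ y) (Grothendieck.pre y h ⋙ f) β).naturality p)⟩

end Lan

end CatAdder

open CatAdder

/-- A (dependent) right `Cat`-module structure on `M`: for every family `x` of small categories
indexed by a moderately small category `U` a sum operation `Hom(⟦x⟧, M) → Hom(U, M)`, where
`⟦x⟧ = Grothendieck x` is the oplax colimit of `x` and `Hom` denotes isomorphism classes of functors;
natural in `x`, unital, and associative. Small categories live in `Type w`, moderately small ones
in the strictly larger universe `Type (max u (w + 1))`. -/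
structure RightCatModule (M : Type u₁) [Category.{v₁} M] where
  sum {U : Type (max u (w + 1))} [Category.{max u (w + 1)} U] (x : U ⥤ Cat.{w, w}) :
    HoFunctor (Grothendieck x) M → HoFunctor U M
  sum_natural {U V : Type (max u (w + 1))} [Category.{max u (w + 1)} U]
    [Category.{max u (w + 1)} V] (h : U ⥤ V) (x : U ⥤ Cat.{w, w}) (y : V ⥤ Cat.{w, w})
    (α : x ≅ h ⋙ y) (f : HoFunctor (Grothendieck y) M) :
    sum x ((HoFunctor.mk (Grothendieck.map α.hom ⋙ Grothendieck.pre y h)).comp f) =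
      (HoFunctor.mk h).comp (sum y f)
  sum_unit {U : Type (max u (w + 1))} [Category.{max u (w + 1)} U] (f : HoFunctor U M) :
    sum (constOne U) ((HoFunctor.mk (Grothendieck.forget (constOne U))).comp f) = f
  sum_assoc {U : Type (max u (w + 1))} [Category.{max u (w + 1)} U] (x : U ⥤ Cat.{w, w})
    (f : Grothendieck x ⥤ Cat.{w, w}) (g : HoFunctor (Grothendieck (oplaxSum x f)) M) :
    sum (oplaxSum x f) g = sum x (sum f ((HoFunctor.mk (flat x f)).comp g))

namespace RightCatModule

/-- A morphism `φ` of the homotopy category of categories is a `Cat`-linear map if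
`φ ∘ ∑ₓ f = ∑ₓ (φ ∘ f)` for every family `x : U ⥤ Cat` and every `f : ⟦x⟧ → M`. -/
def IsLinearMap {M : Type u₁} [Category.{v₁} M] {N : Type u₂} [Category.{v₂} N]
    (P : RightCatModule.{w, u} M) (Q : RightCatModule.{w, u} N) (φ : HoFunctor M N) : Prop :=
  ∀ (U : Type (max u (w + 1))) [Category.{max u (w + 1)} U] (x : U ⥤ Cat.{w, w})
    (f : HoFunctor (Grothendieck x) M), (P.sum x f).comp φ = Q.sum x (f.comp φ)

/-- The sum operation of a cocomplete category: `∑ₓ f` is the class of the functor sending `u` to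
the colimit of `f(u, -)` over `x(u)`, with the canonical maps between these colimits. -/
def colimSum (M : Type u₁) [Category.{v₁} M] [HasColimitsOfSize.{w, w} M]
    {U : Type u₂} [Category.{v₂} U] (x : U ⥤ Cat.{w, w}) :
    HoFunctor (Grothendieck x) M → HoFunctor U M :=
  Quotient.map (sa := isIsomorphicSetoid (Grothendieck x ⥤ M))
    (sb := isIsomorphicSetoid (U ⥤ M)) (fun f => fiberwiseColimit f)
    (fun _ _ ⟨e⟩ => ⟨(fiberwiseColim x M).mapIso e⟩)

/-- A cocomplete category as a right `Cat`-module, with colimits as dependent sums. -/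
def ofCocomplete (M : Type u₁) [Category.{v₁} M] [HasColimitsOfSize.{w, w} M] :
    RightCatModule.{w, u} M where
  sum x := colimSum M x
  sum_natural h x y α f := by
    induction f using HoFunctor.ind with | _ f =>
    obtain ⟨e₁⟩ := isoClass_map α (Grothendieck.pre y h ⋙ f)
    obtain ⟨e₂⟩ := isoClass_pre h y f
    exact HoFunctor.mk_eq_mk_iff.mpr ⟨e₁ ≪≫ e₂⟩
  sum_unit f := by
    induction f using HoFunctor.ind with | _ f =>
    exact HoFunctor.mk_eq_mk_iff.mpr (isoClass_constOne f)
  sum_assoc x f g := by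
    induction g using HoFunctor.ind with | _ g =>
    exact HoFunctor.mk_eq_mk_iff.mpr (isoClass_oplaxSum x f g)

end RightCatModule

end

noncomputable section

namespace CatAdder

/-! ### Colimit-preserving functors commute with fibrewise colimits. -/

section PreservesColimits

variable {C : Type u₁} [Category.{v₁} C] [HasColimitsOfSize.{w, w} C]
  {D : Type u₂} [Category.{v₂} D] [HasColimitsOfSize.{w, w} D]

/-! If `F` preserves colimits, the canonical comparison of fibrewise colimits is `colimit.post` at
each index, hence invertible.

The converse must cope with linearity providing only some natural isomorphism, not the canonical
comparison. The remedy is to make a colimit cocone part of the functor being compared. Given `G : J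
⥤ C`, adjoin a terminal object to `J`, let `L` be the inclusion, and sum the pullback of `G` over
the comma categories `L / t`. This sum is the pointwise left Kan extension of `G` along `L`
(`commaSumExtensionIsPointwise`). As `L` is fully faithful, the extension restricts to `G`, and its
arrows into the value at the terminal object form a colimit cocone (`isColimitMapTerminalCocone`).
Linearity makes `F` applied to this extension isomorphic to the extension of `G ⋙ F`. Any natural
isomorphism of functors on the enlarged category carries cocones to cocones, so `F` sends the
colimit cocone of `G` to a colimit cocone. -/

/-- A functor that preserves colimits commutes with fibrewise colimits. -/
theorem nonempty_fiberwiseColimit_comp_iso (F : C ⥤ D) [PreservesColimitsOfSize.{w, w} F]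
    {U : Type u₃} [Category.{v₃} U] (x : U ⥤ Cat.{w, w}) (f : Grothendieck x ⥤ C) :
    Nonempty (fiberwiseColimit (f ⋙ F) ≅ fiberwiseColimit f ⋙ F) := by
  let β : f ⋙ F ⟶ Grothendieck.forget x ⋙ fiberwiseColimit f ⋙ F :=
    Functor.whiskerRight (natTransIntoForgetCompFiberwiseColimit f) F
  have h : ∀ u, IsIso ((fiberwiseDesc x (f ⋙ F) β).app u) := by
    intro u
    -- Both maps out of the colimit have the image under `F` of the coprojection as component at
    -- `i`.
    have e : (fiberwiseDesc x (f ⋙ F) β).app u = colimit.post (Grothendieck.ι x u ⋙ f) F := by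
      refine colimit.hom_ext fun i => ?_
      refine (colimit.ι_desc (fiberCocone x (f ⋙ F) β u) i).trans ?_
      exact (colimit.ι_post (Grothendieck.ι x u ⋙ f) F i).symm
    have hpost : IsIso (colimit.post (Grothendieck.ι x u ⋙ f) F) := inferInstance
    rw [e]
    exact hpost
  exact ⟨NatIso.ofComponents (fun u => asIso ((fiberwiseDesc x (f ⋙ F) β).app u))
    (fun p => (fiberwiseDesc x (f ⋙ F) β).naturality p)⟩

end PreservesColimits

/-! ### Left Kan extension as a sum over comma categories. -/

section KanExtension

variable {J : Type w} [Category.{w} J] {U : Type w} [Category.{w} U] (L : J ⥤ U)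

/-- The family of comma categories `L / t`, indexed by a category equivalent to `U` in a larger
universe. -/
def commaFamily : AsSmall.{max u (w + 1)} U ⥤ Cat.{w, w} :=
  AsSmall.down ⋙ CostructuredArrow.functor L

/-- The projection of the oplax colimit of the comma categories `L / t` to `J`. -/
def commaFamilyProj : Grothendieck (commaFamily.{w, u} L) ⥤ J :=
  Grothendieck.pre (CostructuredArrow.functor L) AsSmall.down ⋙
    CostructuredArrow.grothendieckProj L

variable {M : Type u₁} [Category.{v₁} M] [HasColimitsOfSize.{w, w} M] (G : J ⥤ M)

/-- The sum over the comma categories `L / t`, which is the left Kan extension along `L`. -/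
def commaSum : U ⥤ M :=
  AsSmall.up ⋙ fiberwiseColimit (commaFamilyProj.{w, u} L ⋙ G)

/-- The coprojections into the values of `commaSum`. -/
def commaSumι {t : U} (y : CostructuredArrow L t) : G.obj y.left ⟶ (commaSum.{w, u} L G).obj t :=
  colimit.ι (Grothendieck.ι (commaFamily.{w, u} L) (AsSmall.up.obj t) ⋙
    commaFamilyProj.{w, u} L ⋙ G) y

/-- The fibre inclusion only precomposes `k` with an `eqToHom`, whose component in `J` is an
identity. -/
theorem commaFamilyProj_map_ι {t : U} {y z : CostructuredArrow L t} (k : y ⟶ z) :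
    (commaFamilyProj.{w, u} L).map
      ((Grothendieck.ι (commaFamily.{w, u} L) (AsSmall.up.obj t)).map k) = k.left := by
  refine Comma.comp_left.trans ?_
  exact (CostructuredArrow.eqToHom_left _ =≫ k.left).trans (Category.id_comp k.left)

theorem commaFamilyProj_map_ιNatTrans {s t : U} (p : s ⟶ t) (y : CostructuredArrow L s) :
    (commaFamilyProj.{w, u} L).map ((Grothendieck.ιNatTrans (F := commaFamily.{w, u} L)
      (AsSmall.up.map p)).app y) = 𝟙 y.left := by
  rfl

/-- The cocone relation inside one fibre. Together with `commaSumι_comp_map` it reduces computations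
in `commaSum` to morphisms of comma categories. -/
theorem map_comp_commaSumι {t : U} {y z : CostructuredArrow L t} (k : y ⟶ z) :
    G.map k.left ≫ commaSumι.{w, u} L G z = commaSumι L G y := by
  have h := colimit.w (Grothendieck.ι (commaFamily.{w, u} L) (AsSmall.up.obj t) ⋙
    commaFamilyProj.{w, u} L ⋙ G) k
  have e := congrArg G.map (commaFamilyProj_map_ι.{w, u} L k)
  exact (e.symm =≫ _).trans h

theorem commaSumι_comp_map {s t : U} (p : s ⟶ t) (y : CostructuredArrow L s) :
    commaSumι.{w, u} L G y ≫ (commaSum.{w, u} L G).map p =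
      commaSumι L G ((CostructuredArrow.map p).obj y) := by
  have h := ι_fiberwiseColimit_map (commaFamily.{w, u} L) (commaFamilyProj.{w, u} L ⋙ G)
    (AsSmall.up.map p) y
  have e := (congrArg G.map (commaFamilyProj_map_ιNatTrans.{w, u} L p y)).trans (G.map_id _)
  exact h.trans ((e =≫ _).trans (Category.id_comp _))

/-- The left extension of `G` along `L` given by the sum over the comma categories. -/
def commaSumExtension : Functor.LeftExtension L G :=
  Functor.LeftExtension.mk (commaSum.{w, u} L G)
    { app := fun j => commaSumι L G (CostructuredArrow.mk (𝟙 (L.obj j)))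
      naturality := fun i j p => by
        refine Eq.trans ?_ (commaSumι_comp_map L G (L.map p) (CostructuredArrow.mk (𝟙 _))).symm
        -- Here `p` is viewed as a morphism over `L.obj j` from `L.map p` to the identity.
        exact map_comp_commaSumι L G (y := (CostructuredArrow.map (L.map p)).obj
          (CostructuredArrow.mk (𝟙 (L.obj i)))) (z := CostructuredArrow.mk (𝟙 (L.obj j)))
          (CostructuredArrow.homMk p (by simp)) }

/-- `commaSumExtension` is a pointwise left Kan extension. -/
def commaSumExtensionIsPointwise :
    (commaSumExtension.{w, u} L G).IsPointwiseLeftKanExtension := fun t =>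
  -- Pushing the identity of `L.obj y.left` along `y.hom` gives back `y`, up to a morphism with
  -- identity component in `J`. So the legs of the Kan extension cocone are the coprojections of the
  -- colimit over `L / t`.
  have hι (y : CostructuredArrow L t) :
      ((commaSumExtension.{w, u} L G).coconeAt t).ι.app y = commaSumι L G y := by
    refine (commaSumι_comp_map L G y.hom (CostructuredArrow.mk (𝟙 _))).trans ?_
    refine (map_comp_commaSumι L G (y := (CostructuredArrow.map y.hom).obj
      (CostructuredArrow.mk (𝟙 _))) (z := y) (CostructuredArrow.homMk (𝟙 _) (by simp))).symm.trans ?_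
    exact (G.map_id _ =≫ _).trans (Category.id_comp _)
  let e : CostructuredArrow.proj L t ⋙ G ≅ Grothendieck.ι (commaFamily.{w, u} L)
      (AsSmall.up.obj t) ⋙ commaFamilyProj.{w, u} L ⋙ G :=
    NatIso.ofComponents (fun _ => Iso.refl _) (fun k => 
      (Category.comp_id _).trans ((congrArg G.map (commaFamilyProj_map_ι.{w, u} L k)).symm.trans
        (Category.id_comp _).symm))
  IsColimit.ofIsoColimit ((IsColimit.precomposeHomEquiv e _).symm (colimit.isColimit _))
    (Cocone.ext (Iso.refl _) (fun y => (Category.comp_id _).trans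
      ((Category.id_comp _).trans (hι y).symm)))

/-! ### Colimit cocones read off from a Kan extension at a terminal object. -/

/-- The canonical cocone under a functor with vertex a terminal object. -/
def terminalCocone {T : U} (hT : IsTerminal T) : Cocone L where
  pt := T
  ι := { app := fun j => hT.from (L.obj j)
         naturality := fun _ _ _ => hT.hom_ext _ _ }

/-- A pointwise left Kan extension along a fully faithful functor sends the canonical cocone at
a terminal object to a colimit cocone. -/
def isColimitMapTerminalCocone [L.Full] [L.Faithful] {T : U} (hT : IsTerminal T)
    (E : Functor.LeftExtension L G) (hE : E.IsPointwiseLeftKanExtension) :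
    IsColimit (E.right.mapCocone (terminalCocone L hT)) :=
  -- Full faithfulness of `L` makes the unit invertible, so cocones under `L ⋙ E.right` and under
  -- `G` correspond.
  have := hE.isIso_hom
  let c (s : Cocone (L ⋙ E.right)) : Cocone (CostructuredArrow.proj L T ⋙ G) :=
    ((Cocone.precompose E.hom).obj s).whisker (CostructuredArrow.proj L T)
  { desc := fun s => (hE T).desc (c s)
    fac := fun s j => by
      rw [← cancel_epi (E.hom.app j)]
      exact (Category.assoc _ _ _).symm.trans
        ((hE T).fac (c s) (CostructuredArrow.mk (hT.from (L.obj j))))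
    uniq := fun s m hm => (hE T).hom_ext fun y => by
      refine Eq.trans ?_ ((hE T).fac (c s) y).symm
      -- An object of `L / T` carries no data beyond its object of `J`, so the legs indexed by `J`
      -- determine `m`.
      have hy : y.hom = hT.from (L.obj y.left) := hT.hom_ext _ _
      have h : E.right.map y.hom ≫ m = s.ι.app y.left := by
        rw [hy]
        exact hm y.left
      exact (Category.assoc _ _ _).trans (congrArg (E.hom.app y.left ≫ ·) h) }

end KanExtension

end CatAdder
end

/-! ### Linearity is equivalent to preservation of colimits. -/

open CatAdder

theorem mainTheorem12
    {C : Type u₁} [Category.{v₁} C] [HasColimitsOfSize.{w, w} C]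
    {D : Type u₂} [Category.{v₂} D] [HasColimitsOfSize.{w, w} D] (F : C ⥤ D) :
    RightCatModule.IsLinearMap
        (RightCatModule.ofCocomplete.{w, u} C) (RightCatModule.ofCocomplete.{w, u} D)
        (HoFunctor.mk F) ↔
      PreservesColimitsOfSize.{w, w} F := by
  refine ⟨fun hF => ⟨fun {J} _ => ⟨fun {G} => ?_⟩⟩, fun hF U _ x f => ?_⟩
  · let L : J ⥤ WithTerminal J := WithTerminal.incl
    -- Equality of classes yields an isomorphism natural in the index; nothing else about it is
    -- known or needed.
    obtain ⟨e⟩ : Nonempty (fiberwiseColimit (commaFamilyProj.{w, u} L ⋙ G) ⋙ F ≅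
        fiberwiseColimit (commaFamilyProj.{w, u} L ⋙ G ⋙ F)) :=
      HoFunctor.mk_eq_mk_iff.mp (hF (AsSmall.{max u (w + 1)} (WithTerminal J))
        (commaFamily.{w, u} L) (HoFunctor.mk (commaFamilyProj.{w, u} L ⋙ G)))
    let e' : commaSum.{w, u} L (G ⋙ F) ≅ commaSum.{w, u} L G ⋙ F :=
      Functor.isoWhiskerLeft AsSmall.up e.symm
    let c := terminalCocone L WithTerminal.starTerminal
    have hC := isColimitMapTerminalCocone L G WithTerminal.starTerminal _
      (commaSumExtensionIsPointwise.{w, u} L G)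
    have hD := isColimitMapTerminalCocone L (G ⋙ F) WithTerminal.starTerminal _
      (commaSumExtensionIsPointwise.{w, u} L (G ⋙ F))
    -- Naturality of `e'` at the arrows to the terminal object identifies the two image cocones.
    have hCF : IsColimit (F.mapCocone ((commaSum.{w, u} L G).mapCocone c)) :=
      IsColimit.mapCoconeEquiv e' hD
    have : PreservesColimit (L ⋙ commaSum.{w, u} L G) F :=
      preservesColimit_of_preserves_colimit_cocone hC hCF
    -- The unit transfers preservation from the restricted extension back to `G`.
    have hη := (commaSumExtensionIsPointwise.{w, u} L G).isIso_hom
    let i : G ≅ L ⋙ commaSum.{w, u} L G :=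
      @asIso _ _ _ _ (commaSumExtension.{w, u} L G).hom hη
    exact preservesColimit_of_iso_diagram F i.symm
  · induction f using HoFunctor.ind with | _ f =>
    obtain ⟨e⟩ := nonempty_fiberwiseColimit_comp_iso F x f
    exact HoFunctor.mk_eq_mk_iff.mpr ⟨e.symm⟩
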